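/- **Conventions.** A \emph{graph} $\Gamma$ consists of a set $V(\Gamma)$ of vertices, a set $\overrightarrow{E}(\Gamma)$ of directed edges, a fixed point free involution $e\mapsto e^{-1}$ of $\overrightarrow{E}(\Gamma)$ and a terminus map $\tau:\overrightarrow{E}(\Gamma)\to V(\Gamma)$; thus loops and parallel edges are allowed. Its set of undirected edges is $E(\Gamma)=\overrightarrow{E}(\Gamma)/{}^{-1}$, and the degree of a vertex $v$ is $|\tau^{-1}(v)|$. An isomorphism is a pair of bijections, on vertices and on directed edges, commuting with ${}^{-1}$ and $\tau$. A graph is connected if it is non-empty and any two of its vertices are joined by a walk. A cycle has length $n$ with $1\le n\le\infty$: a cycle of length $1$ is a loop, one of length $2$ is a pair of parallel edges, and one of length $\infty$ is a two-way infinite path. A \emph{weak multicycle} is a graph that is a vertex-disjoint union of cycles and single edges (an edge with two distinct endvertices). A \emph{weak multicycle colouring} of $\Gamma$ is a map $c:E(\Gamma)\to\Omega$ to some set such that for every $\omega\in\Omega$ the graph with vertex set $V(\Gamma)$ and edge set $c^{-1}(\omega)$ is a weak multicycle; it is \emph{partition-friendly} if each of these graphs is regular (so each is either a spanning disjoint union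 of cycles or a perfect matching). A \emph{partite presentation} $P=\langle X\mid\mathcal U\mid\mathcal I\mid\phi\mid\mathcal R\rangle$ consists of a non-empty set $X$; disjoint sets $\mathcal U,\mathcal I$ with union $\mathcal S$, which define the group $MF_P=\langle\mathcal S\mid s^2\ (s\in\mathcal I)\rangle$; a map $\phi:\mathcal S\to\mathrm{Sym}(X)$ such that $\phi(s)$ is a fixed point free involution for each $s\in\mathcal I$ and such that the induced right action $x\cdot s_1\cdots s_n=\phi(s_n)\circ\cdots\circ\phi(s_1)(x)$ of $MF_P$ on $X$ (with $\phi(s^{-1})=\phi(s)^{-1}$) is transitive; and, for each $x\in X$, a set $\mathcal R_x\subseteq MF_P$ of elements fixing $x$. Let $T_P$ be the tree with vertex set $MF_P$ that has, for each $w\in MF_P$ and $s\in\mathcal S\cup\mathcal S^{-1}$ (where $s^{-1}=s$ for $s\in\mathcal I$), a directed edge of colour $s$ from $w$ to $ws$, whose inverse is the edge of colour $s^{-1}$ from $ws$ to $w$. For $x\in X$ let $R_x$ be the subgroup of $MF_P$ generated by all $wrw^{-1}$ with $w\in MF_P$ and $r\in\mathcal R_{x\cdot w}$. Fix $b\in X$.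 Call vertices $g,h$ of $T_P$ equivalent if $b\cdot g=b\cdot h=:x$ and $g^{-1}h\in R_x$, and call two directed edges equivalent if they have the same colour, equivalent initial vertices and equivalent terminal vertices. The \emph{partite Cayley graph} $\mathrm{Sp}(P)$ is the quotient of $T_P$ by these relations; up to isomorphism it does not depend on $b$. **Theorem.** A connected graph $\Gamma$ has a partition-friendly weak multicycle colouring if and only if $\Gamma$ is isomorphic to $\mathrm{Sp}(P)$ for some partite presentation $P$. -/

import Mathlib

universe u v

/-- A graph in the sense of Gersten and Serre: vertices, directed edges, a fixed point free
involution on the directed edges, and a terminus map. Loops and parallel edges are allowed. -/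
structure SerreGraph where
  V : Type u
  E : Type u
  inv : E → E
  inv_inv : ∀ e, inv (inv e) = e
  inv_ne : ∀ e, inv e ≠ e
  tau : E → V

namespace SerreGraph

/-- Isomorphisms: bijections on vertices and on directed edges that commute with the involution
and the terminus map. -/
structure Iso (G : SerreGraph.{u}) (H : SerreGraph.{v}) where
  onV : G.V ≃ H.V
  onE : G.E ≃ H.E
  map_inv : ∀ e, onE (G.inv e) = H.inv (onE e)
  map_tau : ∀ e, onV (G.tau e) = H.tau (onE e)

/-- The degree of a vertex: the cardinality of `tau ⁻¹ {x}` (so a loop counts twice). -/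
def degree (G : SerreGraph.{u}) (x : G.V) : Cardinal.{u} :=
  Cardinal.mk {e : G.E // G.tau e = x}

def IsRegular (G : SerreGraph.{u}) : Prop :=
  ∃ k : Cardinal.{u}, ∀ x, G.degree x = k

/-- There is a directed edge from `x` to `y`. -/
def Step (G : SerreGraph.{u}) (x y : G.V) : Prop :=
  ∃ e : G.E, G.tau (G.inv e) = x ∧ G.tau e = y

/-- Nonempty, and any two vertices are joined by a walk. -/
def Connected (G : SerreGraph.{u}) : Prop :=
  Nonempty G.V ∧ ∀ x y : G.V, Relation.ReflTransGen G.Step x y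

/-- The undirected edges: directed edges modulo the involution. -/
def UEdge (G : SerreGraph.{u}) : Type u :=
  Quot fun e f : G.E => f = G.inv e

/-- The undirected edge underlying a directed edge. -/
def toUEdge (G : SerreGraph.{u}) (e : G.E) : G.UEdge :=
  Quot.mk _ e

theorem toUEdge_inv (G : SerreGraph.{u}) (e : G.E) : G.toUEdge (G.inv e) = G.toUEdge e :=
  (Quot.sound (r := fun e f : G.E => f = G.inv e) (a := e) rfl).symm

/-- The disjoint union of a family of graphs. -/
def disjUnion {ι : Type u} (G : ι → SerreGraph.{v}) : SerreGraph.{max u v} where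
  V := Σ i, (G i).V
  E := Σ i, (G i).E
  inv e := ⟨e.1, (G e.1).inv e.2⟩
  inv_inv e := by simp [(G e.1).inv_inv]
  inv_ne := by
    rintro ⟨i, e⟩ h
    exact (G i).inv_ne e (by simpa using h)
  tau e := ⟨e.1, (G e.1).tau e.2⟩

/-- The cycle of length `n`: the vertex set is `ZMod n`, and `(i, true)`, `(i, false)` are the two
orientations of the edge between `i` and `i + 1`. For `n = 1` this is a loop, for `n = 2` a pair of
parallel edges, and for `n = 0`, where `ZMod 0 = ℤ`, it is the infinite cycle, that is, the
two-way infinite path. -/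
def cycle (n : ℕ) : SerreGraph.{0} where
  V := ZMod n
  E := ZMod n × Bool
  inv e := (e.1, !e.2)
  inv_inv e := by simp
  inv_ne e h := by
    have := congrArg Prod.snd h
    simp at this
  tau e := if e.2 then e.1 + 1 else e.1

/-- Two vertices joined by one edge; the directed edge `b` ends at the vertex `b`. -/
def singleEdge : SerreGraph.{0} where
  V := Bool
  E := Bool
  inv e := !e
  inv_inv e := by simp
  inv_ne e := by simp
  tau e := e

/-- A vertex-disjoint union of (finite or infinite) cycles and single edges. -/
def IsWeakMulticycle (G : SerreGraph.{u}) : Prop :=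
  ∃ (ι : Type u) (H : ι → SerreGraph.{0}),
    (∀ i, (∃ n : ℕ, Nonempty (Iso (H i) (cycle n))) ∨ Nonempty (Iso (H i) singleEdge)) ∧
      Nonempty (Iso G (disjUnion H))

/-- The graph with vertex set `V(G)` whose edges are those of colour `a`. -/
def colourClass (G : SerreGraph.{u}) {Ω : Type u} (c : G.UEdge → Ω) (a : Ω) : SerreGraph.{u} where
  V := G.V
  E := {e : G.E // c (G.toUEdge e) = a}
  inv e := ⟨G.inv e.1, by rw [G.toUEdge_inv]; exact e.2⟩
  inv_inv e := Subtype.ext (G.inv_inv e.1)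
  inv_ne e h := G.inv_ne e.1 (congrArg Subtype.val h)
  tau e := G.tau e.1

def IsWeakMulticycleColouring (G : SerreGraph.{u}) {Ω : Type u} (c : G.UEdge → Ω) : Prop :=
  ∀ a, (G.colourClass c a).IsWeakMulticycle

def IsPartitionFriendly (G : SerreGraph.{u}) {Ω : Type u} (c : G.UEdge → Ω) : Prop :=
  ∀ a, (G.colourClass c a).IsRegular

end SerreGraph

/-- The group `⟨U ∪ I | i² (i ∈ I)⟩`, the free product of infinite cyclic groups, one for each
element of `U`, and cyclic groups of order two, one for each element of `I`. -/
abbrev MixedFreeGroup (U I : Type u) : Type u :=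
  PresentedGroup {r : FreeGroup (U ⊕ I) | ∃ i : I, r = FreeGroup.of (Sum.inr i) ^ 2}

/-- The right action of the group on `X` induced by permutations `φ(s)` of `X`:
`x · (s₁ ⋯ sₙ) = φ(sₙ) (⋯ (φ(s₁) x))`, so that words are read along walks. -/
def mixedAction {X U I : Type u} (φ : U ⊕ I → Equiv.Perm X)
    (hφ : ∀ i x, φ (Sum.inr i) (φ (Sum.inr i) x) = x) :
    MixedFreeGroup U I →* (Equiv.Perm X)ᵐᵒᵖ :=
  PresentedGroup.toGroup (f := fun s => MulOpposite.op (φ s)) (by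
    rintro r ⟨i, rfl⟩
    rw [map_pow, FreeGroup.lift_apply_of, ← MulOpposite.op_pow, ← MulOpposite.op_one]
    congr 1
    ext x
    simp [pow_two, hφ])

/-- A partite presentation `⟨X | U | I | φ | R⟩`. -/
structure PartitePresentation where
  /-- the vertex classes -/
  X : Type u
  U : Type u
  I : Type u
  nonempty : Nonempty X
  φ : U ⊕ I → Equiv.Perm X
  /-- `φ(i)` is a fixed point free involution for `i ∈ I` -/
  φ_invol : ∀ i x, φ (Sum.inr i) (φ (Sum.inr i) x) = x
  φ_fixfree : ∀ i x, φ (Sum.inr i) x ≠ x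
  transitive : ∀ x y, ∃ g : MixedFreeGroup U I, (mixedAction φ φ_invol g).unop x = y
  /-- the relator sets, contained in the stabilisers -/
  R : X → Set (MixedFreeGroup U I)
  R_stab : ∀ x, ∀ r ∈ R x, (mixedAction φ φ_invol r).unop x = x

namespace PartitePresentation

variable (P : PartitePresentation.{u})

abbrev MF : Type u := MixedFreeGroup P.U P.I

/-- `x · g`. -/
def act (x : P.X) (g : P.MF) : P.X := (mixedAction P.φ P.φ_invol g).unop x

theorem act_one (x : P.X) : P.act x 1 = x := by
  simp [act]

theorem act_mul (x : P.X) (g h : P.MF) : P.act x (g * h) = P.act (P.act x g) h := by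
  simp [act]

theorem act_of (x : P.X) (s : P.U ⊕ P.I) : P.act x (PresentedGroup.of s) = P.φ s x := by
  simp [act, mixedAction, PresentedGroup.toGroup.of]

/-- The set `S ∪ S⁻¹` of letters, where `S = U ∪ I`: `inl (u, true)` is `u`, `inl (u, false)` is
`u⁻¹`, and `inr i` is `i = i⁻¹`. -/
abbrev Letter : Type u := (P.U × Bool) ⊕ P.I

def Letter.inv : P.Letter → P.Letter
  | Sum.inl (a, b) => Sum.inl (a, !b)
  | Sum.inr i => Sum.inr i

/-- The group element denoted by a letter. -/
def Letter.val : P.Letter → P.MF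
  | Sum.inl (a, true) => PresentedGroup.of (Sum.inl a)
  | Sum.inl (a, false) => (PresentedGroup.of (Sum.inl a))⁻¹
  | Sum.inr i => PresentedGroup.of (Sum.inr i)

theorem Letter.inv_inv (s : P.Letter) : Letter.inv P (Letter.inv P s) = s := by
  rcases s with ⟨a, b⟩ | i <;> simp [Letter.inv]

theorem Letter.val_inv (s : P.Letter) : Letter.val P (Letter.inv P s) = (Letter.val P s)⁻¹ := by
  rcases s with ⟨a, b | b⟩ | i
  · simp [Letter.inv, Letter.val]
  · simp [Letter.inv, Letter.val]
  · have h : (PresentedGroup.of (Sum.inr i) : P.MF) ^ 2 = 1 :=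
      PresentedGroup.one_of_mem ⟨i, rfl⟩
    simp only [Letter.inv, Letter.val]
    exact eq_inv_of_mul_eq_one_left (by rw [← pow_two, h])

theorem Letter.act_ne {s : P.Letter} (hs : Letter.inv P s = s) (x : P.X) :
    P.act x (Letter.val P s) ≠ x := by
  rcases s with ⟨a, b⟩ | i
  · simp [Letter.inv] at hs
  · simp only [Letter.val, act_of]
    exact P.φ_fixfree i x

/-- The tree `T_P`: the vertices are the group elements, and `(w, s)` is the directed edge from `w`
to `w s`, which has colour `s`. -/
def tree : SerreGraph.{u} where
  V := P.MF
  E := P.MF × P.Letter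
  inv e := (e.1 * Letter.val P e.2, Letter.inv P e.2)
  inv_inv e := by simp [Letter.val_inv, Letter.inv_inv]
  inv_ne e h := by
    have h1 := congrArg Prod.fst h
    have h2 := congrArg Prod.snd h
    dsimp only at h1 h2
    have h3 := P.act_mul (Classical.choice P.nonempty) e.1 (Letter.val P e.2)
    rw [h1] at h3
    exact Letter.act_ne P h2 _ h3.symm
  tau e := e.1 * Letter.val P e.2

theorem tree_tau_inv (e : P.tree.E) : P.tree.tau (P.tree.inv e) = e.1 := by
  simp [tree, Letter.val_inv]

/-- The subgroup `R_x`, generated by all `w r w⁻¹` with `y = x · w` and `r` a relator at `y`. -/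
def relSubgroup (x : P.X) : Subgroup P.MF :=
  Subgroup.closure {g | ∃ w : P.MF, ∃ r ∈ P.R (P.act x w), g = w * r * w⁻¹}

/-- With base class `b`, the class of `g ∈ V(T_P)` is `b · g`. Two vertices are equivalent if they
have the same class `x` and `g⁻¹ h ∈ R_x`. -/
def vertexSetoid (b : P.X) : Setoid P.MF where
  r g h := P.act b g = P.act b h ∧ g⁻¹ * h ∈ P.relSubgroup (P.act b g)
  iseqv :=
    { refl := fun g => ⟨rfl, by
        rw [inv_mul_cancel]
        exact one_mem _⟩
      symm := by
        rintro g h ⟨h1, h2⟩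
        refine ⟨h1.symm, ?_⟩
        have h3 := inv_mem h2
        rw [mul_inv_rev, inv_inv, h1] at h3
        exact h3
      trans := by
        rintro g h k ⟨h1, h2⟩ ⟨h3, h4⟩
        refine ⟨h1.trans h3, ?_⟩
        rw [← h1] at h4
        have h5 := mul_mem h2 h4
        rw [mul_assoc, mul_inv_cancel_left] at h5
        exact h5 }

/-- Two directed edges `e`, `f` of `T_P` are equivalent if they have the same colour, equivalent
termini, and equivalent initial vertices (the vertices `e.1` and `f.1`, see `tree_tau_inv`). -/
def edgeSetoid (b : P.X) : Setoid (P.MF × P.Letter) where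
  r e f := e.2 = f.2 ∧
    P.vertexSetoid b (e.1 * Letter.val P e.2) (f.1 * Letter.val P f.2) ∧
    P.vertexSetoid b e.1 f.1
  iseqv :=
    { refl := fun _ => ⟨rfl, Setoid.refl' _ _, Setoid.refl' _ _⟩
      symm := fun h => ⟨h.1.symm, Setoid.symm' _ h.2.1, Setoid.symm' _ h.2.2⟩
      trans := fun h k => ⟨h.1.trans k.1, Setoid.trans' _ h.2.1 k.2.1,
        Setoid.trans' _ h.2.2 k.2.2⟩ }

/-- The partite Cayley graph, as the quotient of `T_P`, with respect to the base class `b`. -/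
def SpAt (b : P.X) : SerreGraph.{u} where
  V := Quotient (P.vertexSetoid b)
  E := Quotient (P.edgeSetoid b)
  inv := Quotient.map (sa := P.edgeSetoid b) (sb := P.edgeSetoid b) P.tree.inv (by
    rintro ⟨g, s⟩ ⟨h, t⟩ ⟨h1, h2, h3⟩
    dsimp only at h1 h2 h3
    subst h1
    refine ⟨rfl, ?_, h2⟩
    simpa [tree, Letter.val_inv] using h3)
  inv_inv := by
    rintro ⟨e⟩
    exact congrArg (Quotient.mk (P.edgeSetoid b)) (P.tree.inv_inv e)
  inv_ne := by
    rintro ⟨e⟩ h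
    have h' : P.edgeSetoid b (P.tree.inv e) e := Quotient.exact h
    obtain ⟨h1, -, h2⟩ := h'
    have h3 : P.act b (e.1 * Letter.val P e.2) = P.act b e.1 := h2.1
    rw [act_mul] at h3
    exact Letter.act_ne P h1 _ h3
  tau := Quotient.map (sa := P.edgeSetoid b) (sb := P.vertexSetoid b) P.tree.tau
    (fun _ _ h => h.2.1)

/-- The partite Cayley graph `Sp(P)`. The base class is immaterial, see `SpAt_iso`. -/
noncomputable def Sp : SerreGraph.{u} := P.SpAt (Classical.choice P.nonempty)

theorem vertexSetoid_mul (b : P.X) (k g h : P.MF) :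
    P.vertexSetoid b (k * g) (k * h) ↔ P.vertexSetoid (P.act b k) g h := by
  change (P.act b (k * g) = P.act b (k * h) ∧
      (k * g)⁻¹ * (k * h) ∈ P.relSubgroup (P.act b (k * g))) ↔
    (P.act (P.act b k) g = P.act (P.act b k) h ∧
      g⁻¹ * h ∈ P.relSubgroup (P.act (P.act b k) g))
  rw [act_mul, act_mul, mul_inv_rev, mul_assoc, inv_mul_cancel_left]

theorem SpAt_iso (b b' : P.X) : Nonempty (SerreGraph.Iso (P.SpAt b) (P.SpAt b')) := by
  obtain ⟨k, hk⟩ := P.transitive b' b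
  change P.act b' k = b at hk
  subst hk
  have hE : ∀ e f : P.MF × P.Letter, P.edgeSetoid (P.act b' k) e f ↔
      P.edgeSetoid b' (k * e.1, e.2) (k * f.1, f.2) := by
    intro e f
    change (e.2 = f.2 ∧ P.vertexSetoid _ _ _ ∧ P.vertexSetoid _ _ _) ↔
      (e.2 = f.2 ∧ P.vertexSetoid b' (k * e.1 * _) (k * f.1 * _) ∧
        P.vertexSetoid b' (k * e.1) (k * f.1))
    rw [mul_assoc, mul_assoc, vertexSetoid_mul, vertexSetoid_mul]
  refine ⟨⟨Quotient.congr (Equiv.mulLeft k) fun g h => (P.vertexSetoid_mul b' k g h).symm,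
    Quotient.congr ((Equiv.mulLeft k).prodCongr (Equiv.refl _)) hE, ?_, ?_⟩⟩
  · rintro ⟨e⟩
    refine congrArg (Quotient.mk (P.edgeSetoid b')) (Prod.ext ?_ rfl)
    exact (mul_assoc k e.1 (Letter.val P e.2)).symm
  · rintro ⟨e⟩
    exact congrArg (Quotient.mk (P.vertexSetoid b')) (mul_assoc k e.1 (Letter.val P e.2)).symm

end PartitePresentation

namespace SerreGraph

variable {G : SerreGraph.{u}}

/-- The formal inverse of a letter of `S ∪ S⁻¹`, where `S = U ∪ I`. -/
def letterInv {U I : Type u} : (U × Bool) ⊕ I → (U × Bool) ⊕ I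
  | Sum.inl (a, b) => Sum.inl (a, !b)
  | Sum.inr i => Sum.inr i

/-- The generator underlying a letter. -/
def letterColour {U I : Type u} : (U × Bool) ⊕ I → U ⊕ I
  | Sum.inl (a, _) => Sum.inl a
  | Sum.inr i => Sum.inr i

/-- The letter given by a generator. -/
def letterOf {U I : Type u} : U ⊕ I → (U × Bool) ⊕ I
  | Sum.inl a => Sum.inl (a, true)
  | Sum.inr i => Sum.inr i

theorem letterInv_letterInv {U I : Type u} (s : (U × Bool) ⊕ I) :
    letterInv (letterInv s) = s := by
  rcases s with ⟨a, b⟩ | i <;> simp [letterInv]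

theorem letterColour_letterInv {U I : Type u} (s : (U × Bool) ⊕ I) :
    letterColour (letterInv s) = letterColour s := by
  rcases s with ⟨a, b⟩ | i <;> rfl

/-- A labelling of the directed edges by letters, compatible with inversion, such that each vertex
is the initial vertex of exactly one edge of each label. -/
structure Labelling (G : SerreGraph.{u}) (U I : Type u) where
  label : G.E → (U × Bool) ⊕ I
  label_inv : ∀ e, label (G.inv e) = letterInv (label e)
  existsUnique : ∀ x s, ∃! e, G.tau (G.inv e) = x ∧ label e = s

namespace Labelling

variable {U I : Type u} (L : G.Labelling U I)

/-- The edge with initial vertex `x` and label `s`. -/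
noncomputable def edge (x : G.V) (s : (U × Bool) ⊕ I) : G.E := (L.existsUnique x s).choose

theorem source_edge (x : G.V) (s : (U × Bool) ⊕ I) : G.tau (G.inv (L.edge x s)) = x :=
  (L.existsUnique x s).choose_spec.1.1

theorem label_edge (x : G.V) (s : (U × Bool) ⊕ I) : L.label (L.edge x s) = s :=
  (L.existsUnique x s).choose_spec.1.2

theorem eq_edge (e : G.E) : e = L.edge (G.tau (G.inv e)) (L.label e) :=
  (L.existsUnique _ _).choose_spec.2 e ⟨rfl, rfl⟩

theorem edge_injective {x y : G.V} {s t : (U × Bool) ⊕ I} (h : L.edge x s = L.edge y t) :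
    x = y ∧ s = t := by
  constructor
  · rw [← L.source_edge x s, h, L.source_edge]
  · rw [← L.label_edge x s, h, L.label_edge]

/-- The end of the edge with initial vertex `x` and label `s`. -/
noncomputable def next (s : (U × Bool) ⊕ I) (x : G.V) : G.V := G.tau (L.edge x s)

theorem inv_edge (x : G.V) (s : (U × Bool) ⊕ I) :
    G.inv (L.edge x s) = L.edge (L.next s x) (letterInv s) := by
  rw [L.eq_edge (G.inv (L.edge x s)), L.label_inv, L.label_edge, G.inv_inv, next]

theorem next_letterInv_next (s : (U × Bool) ⊕ I) (x : G.V) :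
    L.next (letterInv s) (L.next s x) = x := by
  rw [next, ← inv_edge, source_edge]

theorem next_ne_self {s : (U × Bool) ⊕ I} (hs : letterInv s = s) (x : G.V) :
    L.next s x ≠ x := by
  intro h
  have := L.inv_edge x s
  rw [h, hs] at this
  exact G.inv_ne _ this

/-- The permutation of the vertices that follows the edges labelled `s`. -/
noncomputable def perm (s : (U × Bool) ⊕ I) : Equiv.Perm G.V where
  toFun := L.next s
  invFun := L.next (letterInv s)
  left_inv := L.next_letterInv_next s
  right_inv x := by
    simpa [letterInv_letterInv] using L.next_letterInv_next (letterInv s) x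

/-- The colouring of the undirected edges by the generators underlying their labels. -/
def colour : G.UEdge → U ⊕ I :=
  Quot.lift (fun e => letterColour (L.label e)) (by
    rintro e _ rfl
    rw [L.label_inv, letterColour_letterInv])

theorem colour_toUEdge (e : G.E) : L.colour (G.toUEdge e) = letterColour (L.label e) := rfl

theorem isPartitionFriendly_colour : G.IsPartitionFriendly L.colour := by
  intro a
  refine ⟨Cardinal.mk {s : (U × Bool) ⊕ I // letterColour s = a}, fun (x : G.V) => ?_⟩
  refine Cardinal.mk_congr (Equiv.ofBijective (fun e => ⟨letterInv (L.label e.1.1), ?_⟩) ⟨?_, ?_⟩)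
  · rw [letterColour_letterInv]
    exact e.1.2
  · rintro ⟨⟨e, he⟩, hx⟩ ⟨⟨f, hf⟩, hy⟩ h
    have h1 : letterInv (L.label e) = letterInv (L.label f) :=
      congrArg Subtype.val h
    have h2 : G.tau e = G.tau f := hx.trans hy.symm
    rw [← L.label_inv, ← L.label_inv] at h1
    have h3 : G.inv e = G.inv f := by
      rw [L.eq_edge (G.inv e), L.eq_edge (G.inv f), G.inv_inv, G.inv_inv, h1, h2]
    have h4 : e = f := by rw [← G.inv_inv e, h3, G.inv_inv]
    subst h4
    rfl
  · rintro ⟨s, hs⟩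
    refine ⟨⟨⟨G.inv (L.edge x s), ?_⟩, L.source_edge x s⟩, ?_⟩
    · rw [colour_toUEdge, L.label_inv, L.label_edge, letterColour_letterInv, hs]
    · apply Subtype.ext
      change letterInv (L.label (G.inv (L.edge x s))) = s
      rw [L.label_inv, L.label_edge, letterInv_letterInv]

/-- The orbits of a permutation `σ` can be indexed by `ZMod n` so that `σ` adds one. -/
theorem exists_cyclic_parametrisation {V : Type u} (σ : Equiv.Perm V) :
    ∃ (ι : Type u) (n : ι → ℕ) (f : (Σ i, ZMod (n i)) ≃ V),
      ∀ i k, f ⟨i, k + 1⟩ = σ (f ⟨i, k⟩) := by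
  let Z := Subgroup.zpowers σ
  refine ⟨MulAction.orbitRel.Quotient Z V,
    fun ω => Function.minimalPeriod (σ • ·) ω.out,
    (Equiv.sigmaCongrRight fun ω : MulAction.orbitRel.Quotient Z V => (MulAction.orbitZPowersEquiv σ ω.out).symm).trans
      (MulAction.selfEquivSigmaOrbits Z V).symm, ?_⟩
  intro i k
  obtain ⟨j, rfl⟩ := ZMod.intCast_surjective k
  have key : ∀ j : ℤ, ((MulAction.orbitZPowersEquiv σ i.out).symm
      ((j : ℤ) : ZMod (Function.minimalPeriod (σ • ·) i.out)) : V) = (σ ^ j) i.out := by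
    intro j
    rw [MulAction.orbitZPowersEquiv_symm_apply']
    rfl
  have key' : ∀ (k : ZMod (Function.minimalPeriod (σ • ·) i.out)),
      ((Equiv.sigmaCongrRight fun ω : MulAction.orbitRel.Quotient Z V =>
        (MulAction.orbitZPowersEquiv σ ω.out).symm).trans
        (MulAction.selfEquivSigmaOrbits Z V).symm) ⟨i, k⟩ =
        ((MulAction.orbitZPowersEquiv σ i.out).symm k : V) := fun k => rfl
  rw [key', key', ← Int.cast_one, ← Int.cast_add, key, key, add_comm, zpow_add, zpow_one]
  rfl

/-- A fixed point free involution partitions its domain into pairs. -/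
theorem exists_pairing {V : Type u} (σ : V → V) (h : ∀ x, σ (σ x) = x) (h' : ∀ x, σ x ≠ x) :
    ∃ (ι : Type u) (f : (Σ _ : ι, Bool) ≃ V), ∀ i b, f ⟨i, !b⟩ = σ (f ⟨i, b⟩) := by
  let S : Setoid V :=
    { r := fun x y => y = x ∨ y = σ x
      iseqv :=
        { refl := fun x => Or.inl rfl
          symm := by
            rintro x y (rfl | rfl)
            · exact Or.inl rfl
            · exact Or.inr (h x).symm
          trans := by
            rintro x y z (rfl | rfl) (rfl | rfl)
            · exact Or.inl rfl
            · exact Or.inr rfl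
            · exact Or.inr rfl
            · exact Or.inl (h x) } }
  have hout : ∀ x : V, x = (Quotient.mk S x).out ∨ x = σ (Quotient.mk S x).out :=
    fun x => Quotient.mk_out (s := S) x
  have hσ : ∀ x : V, Quotient.mk S (σ x) = Quotient.mk S x :=
    fun x => (Quotient.sound (s := S) (Or.inr rfl)).symm
  let f : (Σ _ : Quotient S, Bool) → V := fun p => if p.2 then p.1.out else σ p.1.out
  have hf : ∀ p, Quotient.mk S (f p) = p.1 := by
    rintro ⟨i, _ | _⟩
    · exact (hσ _).trans (Quotient.out_eq i)
    · exact Quotient.out_eq i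
  refine ⟨Quotient S, Equiv.ofBijective f ⟨?_, ?_⟩, ?_⟩
  · rintro ⟨i, b⟩ ⟨j, d⟩ hp
    have h1 : i = j := (hf ⟨i, b⟩).symm.trans ((congrArg _ hp).trans (hf ⟨j, d⟩))
    subst h1
    rcases b with _ | _ <;> rcases d with _ | _
    · rfl
    · exact absurd hp (h' _)
    · exact absurd hp.symm (h' _)
    · rfl
  · intro x
    rcases hout x with hx | hx
    · exact ⟨⟨Quotient.mk S x, true⟩, hx.symm⟩
    · exact ⟨⟨Quotient.mk S x, false⟩, hx.symm⟩
  · rintro i (_ | _)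
    · exact (h _).symm
    · rfl

/-- Inverse of an isomorphism. -/
def _root_.SerreGraph.Iso.symm {G : SerreGraph.{u}} {H : SerreGraph.{v}} (f : Iso G H) :
    Iso H G where
  onV := f.onV.symm
  onE := f.onE.symm
  map_inv e := by rw [Equiv.symm_apply_eq, f.map_inv, Equiv.apply_symm_apply]
  map_tau e := by rw [Equiv.symm_apply_eq, f.map_tau, Equiv.apply_symm_apply]

theorem isWeakMulticycle_inl (a : U) : (G.colourClass L.colour (Sum.inl a)).IsWeakMulticycle := by
  obtain ⟨ι, n, f, hf⟩ := exists_cyclic_parametrisation (L.perm (Sum.inl (a, true)))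
  have hf' : ∀ i k, f ⟨i, k + 1⟩ = L.next (Sum.inl (a, true)) (f ⟨i, k⟩) := hf
  refine ⟨ι, fun i => cycle (n i), fun i => Or.inl ⟨n i, ⟨⟨.refl _, .refl _, fun _ => rfl,
    fun _ => rfl⟩⟩⟩, ⟨Iso.symm ?_⟩⟩
  let F : (disjUnion fun i => cycle (n i)).E → G.E := fun e =>
    L.edge (f ⟨e.1, if e.2.2 then e.2.1 else e.2.1 + 1⟩) (Sum.inl (a, e.2.2))
  refine ⟨f, Equiv.ofBijective (fun e => ⟨F e, ?_⟩) ⟨?_, ?_⟩, ?_, ?_⟩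
  · rw [colour_toUEdge, L.label_edge]
    rfl
  · rintro ⟨i, k, b⟩ ⟨j, l, d⟩ h
    have h0 : F ⟨i, k, b⟩ = F ⟨j, l, d⟩ := congrArg Subtype.val h
    obtain ⟨h1, h2⟩ := L.edge_injective h0
    obtain rfl : b = d := congrArg Prod.snd (Sum.inl_injective h2)
    have h3 := f.injective h1
    obtain rfl : i = j := congrArg Sigma.fst h3
    have h4 := eq_of_heq (Sigma.mk.inj h3).2
    cases b
    · obtain rfl : k = l := add_right_cancel h4
      rfl
    · obtain rfl : k = l := h4
      rfl
  · rintro ⟨e, he⟩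
    obtain ⟨b, hb⟩ : ∃ b, L.label e = Sum.inl (a, b) := by
      rw [colour_toUEdge] at he
      rcases hl : L.label e with ⟨a', b⟩ | i
      · rw [hl] at he
        obtain rfl : a' = a := Sum.inl_injective he
        exact ⟨b, rfl⟩
      · rw [hl] at he
        cases he
    obtain ⟨⟨i, k⟩, hk⟩ := f.surjective (G.tau (G.inv e))
    refine ⟨⟨i, if b then k else k - 1, b⟩, Subtype.ext ?_⟩
    change L.edge _ _ = e
    rw [L.eq_edge e, hb, ← hk]
    cases b
    · change L.edge (f ⟨i, k - 1 + 1⟩) _ = _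
      rw [sub_add_cancel]
    · rfl
  · rintro ⟨i, k, b⟩
    apply Subtype.ext
    cases b
    · change L.edge (f ⟨i, k⟩) (Sum.inl (a, true)) =
        G.inv (L.edge (f ⟨i, k + 1⟩) (Sum.inl (a, false)))
      have := L.inv_edge (f ⟨i, k⟩) (Sum.inl (a, true))
      rw [← hf'] at this
      change _ = L.edge _ (Sum.inl (a, false)) at this
      rw [← this, G.inv_inv]
    · change L.edge (f ⟨i, k + 1⟩) (Sum.inl (a, false)) =
        G.inv (L.edge (f ⟨i, k⟩) (Sum.inl (a, true)))
      rw [L.inv_edge, ← hf']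
      rfl
  · rintro ⟨i, k, b⟩
    cases b
    · change f ⟨i, k⟩ = L.next (Sum.inl (a, false)) (f ⟨i, k + 1⟩)
      rw [hf']
      exact (L.next_letterInv_next (Sum.inl (a, true)) _).symm
    · exact hf' i k

theorem isWeakMulticycle_inr (a : I) : (G.colourClass L.colour (Sum.inr a)).IsWeakMulticycle := by
  have hinv : ∀ x, L.next (Sum.inr a) (L.next (Sum.inr a) x) = x :=
    L.next_letterInv_next (Sum.inr a)
  obtain ⟨ι, f, hf⟩ := exists_pairing (L.next (Sum.inr a)) hinv
    (L.next_ne_self rfl)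
  refine ⟨ι, fun i => singleEdge, fun i => Or.inr ⟨⟨.refl _, .refl _, fun _ => rfl,
    fun _ => rfl⟩⟩, ⟨Iso.symm ?_⟩⟩
  let F : (disjUnion fun _ : ι => singleEdge).E → G.E := fun e =>
    L.edge (f ⟨e.1, !e.2⟩) (Sum.inr a)
  refine ⟨f, Equiv.ofBijective (fun e => ⟨F e, ?_⟩) ⟨?_, ?_⟩, ?_, ?_⟩
  · rw [colour_toUEdge, L.label_edge]
    rfl
  · rintro ⟨i, b⟩ ⟨j, d⟩ h
    have h0 : F ⟨i, b⟩ = F ⟨j, d⟩ := congrArg Subtype.val h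
    have h3 := f.injective (L.edge_injective h0).1
    obtain rfl : i = j := congrArg Sigma.fst h3
    have h4 : (!b) = !d := eq_of_heq (Sigma.mk.inj h3).2
    obtain rfl : b = d := Bool.not_inj h4
    rfl
  · rintro ⟨e, he⟩
    have hl : L.label e = Sum.inr a := by
      rw [colour_toUEdge] at he
      rcases hl : L.label e with ⟨a', b⟩ | i
      · rw [hl] at he
        cases he
      · rw [hl] at he
        exact congrArg Sum.inr (Sum.inr_injective he)
    obtain ⟨⟨i, b⟩, hk⟩ := f.surjective (G.tau (G.inv e))
    refine ⟨⟨i, !b⟩, Subtype.ext ?_⟩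
    change L.edge (f ⟨i, !(!b)⟩) _ = e
    rw [L.eq_edge e, hl, ← hk, Bool.not_not]
  · rintro ⟨i, b⟩
    apply Subtype.ext
    change L.edge (f ⟨i, !(!b)⟩) (Sum.inr a) = G.inv (L.edge (f ⟨i, !b⟩) (Sum.inr a))
    rw [L.inv_edge, hf i (!b)]
    rfl
  · rintro ⟨i, b⟩
    change f ⟨i, b⟩ = L.next (Sum.inr a) (f ⟨i, !b⟩)
    exact ((congrArg _ (hf i b)).trans (hinv _)).symm

theorem isWeakMulticycleColouring_colour : G.IsWeakMulticycleColouring L.colour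
  | Sum.inl a => L.isWeakMulticycle_inl a
  | Sum.inr a => L.isWeakMulticycle_inr a

/-- Transport of a labelling along an isomorphism. -/
def comap {H : SerreGraph.{u}} (f : Iso H G) : H.Labelling U I where
  label e := L.label (f.onE e)
  label_inv e := by rw [f.map_inv, L.label_inv]
  existsUnique x s := by
    obtain ⟨e, ⟨h1, h2⟩, h3⟩ := L.existsUnique (f.onV x) s
    refine ⟨f.onE.symm e, ⟨?_, by simpa using h2⟩, ?_⟩
    · apply f.onV.injective
      rw [f.map_tau, f.map_inv, Equiv.apply_symm_apply, h1]
    · rintro e' ⟨h4, h5⟩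
      rw [Equiv.eq_symm_apply]
      exact h3 _ ⟨by rw [← f.map_inv, ← f.map_tau, h4], h5⟩

end Labelling

/-- The edges can be directed so that each vertex has one outgoing and one incoming edge. -/
def IsCyclicallyOrientable (G : SerreGraph.{u}) : Prop :=
  ∃ o : G.E → Bool, (∀ e, o (G.inv e) = !o e) ∧
    ∀ x b, ∃! e, G.tau (G.inv e) = x ∧ o e = b

theorem isCyclicallyOrientable_cycle (n : ℕ) : (cycle n).IsCyclicallyOrientable := by
  refine ⟨Prod.snd, fun _ => rfl, ?_⟩
  intro (x : ZMod n) b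
  cases b
  · refine ⟨(x - (1 : ZMod n), false), ⟨sub_add_cancel x 1, rfl⟩, ?_⟩
    rintro ⟨y, b⟩ ⟨h, rfl⟩
    have h' : (y : ZMod n) + 1 = x := h
    rw [← h', add_sub_cancel_right]
  · refine ⟨(x, true), ⟨rfl, rfl⟩, ?_⟩
    rintro ⟨y, b⟩ ⟨h, rfl⟩
    have h' : (y : ZMod n) = x := h
    rw [← h']

theorem IsCyclicallyOrientable.comap {G : SerreGraph.{u}} {H : SerreGraph.{v}} (f : Iso H G)
    (h : G.IsCyclicallyOrientable) : H.IsCyclicallyOrientable := by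
  obtain ⟨o, ho, h⟩ := h
  refine ⟨fun e => o (f.onE e), fun e => (congrArg o (f.map_inv e)).trans (ho _), fun x s => ?_⟩
  obtain ⟨e, ⟨h1, h2⟩, h3⟩ := h (f.onV x) s
  refine ⟨f.onE.symm e, ⟨?_, by simpa using h2⟩, ?_⟩
  · apply f.onV.injective
    rw [f.map_tau, f.map_inv, Equiv.apply_symm_apply, h1]
  · rintro e' ⟨h4, h5⟩
    rw [Equiv.eq_symm_apply]
    exact h3 _ ⟨by rw [← f.map_inv, ← f.map_tau, h4], h5⟩

theorem isCyclicallyOrientable_disjUnion {ι : Type u} {H : ι → SerreGraph.{v}}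
    (h : ∀ i, (H i).IsCyclicallyOrientable) : (disjUnion H).IsCyclicallyOrientable := by
  choose o ho h using h
  refine ⟨fun e => o e.1 e.2, fun e => ho e.1 e.2, ?_⟩
  rintro ⟨i, x⟩ b
  obtain ⟨e, ⟨h1, h2⟩, h3⟩ := h i x b
  refine ⟨⟨i, e⟩, ⟨congrArg (Sigma.mk i) h1, h2⟩, ?_⟩
  rintro ⟨j, e'⟩ ⟨h4, h5⟩
  obtain rfl : j = i := congrArg Sigma.fst h4
  have h6 := eq_of_heq (Sigma.mk.inj h4).2
  rw [h3 e' ⟨h6, h5⟩]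

/-- Some vertex has degree one. -/
def HasLeaf (G : SerreGraph.{u}) : Prop :=
  ∃ (t : G.V) (ε : G.E), ∀ e, G.tau e = t ↔ e = ε

theorem HasLeaf.comap {G : SerreGraph.{u}} {H : SerreGraph.{v}} (f : Iso H G)
    (h : G.HasLeaf) : H.HasLeaf := by
  obtain ⟨t, ε, h⟩ := h
  refine ⟨f.onV.symm t, f.onE.symm ε, fun e => ?_⟩
  rw [Equiv.eq_symm_apply, Equiv.eq_symm_apply, f.map_tau, h]

theorem HasLeaf.disjUnion {ι : Type u} {H : ι → SerreGraph.{v}} {i : ι} (h : (H i).HasLeaf) :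
    (disjUnion H).HasLeaf := by
  obtain ⟨t, ε, h⟩ := h
  refine ⟨⟨i, t⟩, ⟨i, ε⟩, ?_⟩
  rintro ⟨j, e⟩
  constructor
  · intro he
    obtain rfl : j = i := congrArg Sigma.fst he
    exact congrArg (Sigma.mk j) ((h e).1 (eq_of_heq (Sigma.mk.inj he).2))
  · intro he
    obtain rfl : j = i := congrArg Sigma.fst he
    exact congrArg (Sigma.mk j) ((h e).2 (eq_of_heq (Sigma.mk.inj he).2))

/-- A regular weak multicycle is a perfect matching or a disjoint union of cycles. -/
theorem IsWeakMulticycle.matching_or_orientable (h : G.IsWeakMulticycle) (hr : G.IsRegular) :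
    (∀ x, ∃! e, G.tau e = x) ∨ G.IsCyclicallyOrientable := by
  obtain ⟨ι, H, hH, ⟨f⟩⟩ := h
  by_cases hc : ∀ i, ∃ n : ℕ, Nonempty (Iso (H i) (cycle n))
  · right
    refine IsCyclicallyOrientable.comap f (isCyclicallyOrientable_disjUnion fun i => ?_)
    obtain ⟨n, ⟨g⟩⟩ := hc i
    exact (isCyclicallyOrientable_cycle n).comap g
  · left
    obtain ⟨i, hi⟩ := not_forall.1 hc
    obtain ⟨g⟩ := (hH i).resolve_left hi
    obtain ⟨k, hk⟩ := hr
    have hdeg : ∀ x, G.degree x = 1 ↔ ∃! e, G.tau e = x := by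
      intro x
      rw [degree, Cardinal.eq_one_iff_unique, ← unique_subtype_iff_existsUnique,
        unique_iff_subsingleton_and_nonempty]
    have hs : singleEdge.HasLeaf := ⟨true, true, fun _ => Iff.rfl⟩
    obtain ⟨t, ε, ht⟩ := ((hs.comap g).disjUnion).comap f
    obtain rfl : k = 1 := by
      rw [← hk t, hdeg]
      exact ⟨ε, (ht ε).2 rfl, fun e he => (ht e).1 he⟩
    exact fun x => (hdeg x).1 (hk x)

/-- A partition-friendly weak multicycle colouring yields a labelling. -/
theorem exists_labelling {Ω : Type u} (c : G.UEdge → Ω) (hc : G.IsWeakMulticycleColouring c)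
    (hr : G.IsPartitionFriendly c) : ∃ U I : Type u, Nonempty (G.Labelling U I) := by
  classical
  let M : Ω → Prop := fun a => ∀ x, ∃! e, c (G.toUEdge e) = a ∧ G.tau e = x
  have hO : ∀ a : Ω, ∃ o : G.E → Bool, ¬ M a →
      (∀ e, c (G.toUEdge e) = a → o (G.inv e) = !o e) ∧
      ∀ x b, ∃! e, c (G.toUEdge e) = a ∧ G.tau (G.inv e) = x ∧ o e = b := by
    intro a
    rcases (hc a).matching_or_orientable (hr a) with h | ⟨o, ho, h⟩
    · refine ⟨fun _ => true, fun hM => absurd (fun x => ?_) hM⟩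
      obtain ⟨⟨e, he⟩, h1, h2⟩ := h x
      exact ⟨e, ⟨he, h1⟩, fun e' he' => congrArg Subtype.val (h2 ⟨e', he'.1⟩ he'.2)⟩
    · obtain ⟨o', ho'⟩ : ∃ o' : G.E → Bool, ∀ e he, o' e = o ⟨e, he⟩ :=
        ⟨fun e => if he : c (G.toUEdge e) = a then o ⟨e, he⟩ else true, fun e he => dif_pos he⟩
      refine ⟨o', fun _ => ⟨?_, ?_⟩⟩
      · intro e he
        have he' : c (G.toUEdge (G.inv e)) = a := by rw [G.toUEdge_inv, he]
        rw [ho' _ he, ho' _ he']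
        exact ho ⟨e, he⟩
      · intro x b
        obtain ⟨⟨e, he⟩, ⟨h1, h2⟩, h3⟩ := h x b
        refine ⟨e, ⟨he, h1, (ho' e he).trans h2⟩, ?_⟩
        rintro e' ⟨he', h4, h5⟩
        exact congrArg Subtype.val (h3 ⟨e', he'⟩ ⟨h4, (ho' e' he').symm.trans h5⟩)
  choose o ho using hO
  let l : G.E → ({a // ¬ M a} × Bool) ⊕ {a // M a} := fun e =>
    if h : M (c (G.toUEdge e)) then Sum.inr ⟨_, h⟩ else Sum.inl (⟨_, h⟩, o (c (G.toUEdge e)) e)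
  have hl_inr : ∀ e a, l e = Sum.inr a ↔ c (G.toUEdge e) = a.1 := by
    rintro e ⟨a, ha⟩
    by_cases h : M (c (G.toUEdge e))
    · simp [l, h]
    · simp only [l, h, dite_false, reduceCtorEq, false_iff]
      rintro rfl
      exact h ha
  have hl_inl : ∀ e a b, l e = Sum.inl (a, b) ↔ c (G.toUEdge e) = a.1 ∧ o a.1 e = b := by
    rintro e ⟨a, ha⟩ b
    by_cases h : M (c (G.toUEdge e))
    · simp only [l, h, dite_true, reduceCtorEq, false_iff]
      rintro ⟨rfl, -⟩
      exact ha h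
    · simp only [l, h, dite_false, Sum.inl.injEq, Prod.mk.injEq, Subtype.mk.injEq]
      constructor <;> (rintro ⟨rfl, h⟩; exact ⟨rfl, h⟩)
  refine ⟨{a // ¬ M a}, {a // M a}, ⟨⟨l, ?_, ?_⟩⟩⟩
  · intro e
    rcases h : l e with ⟨a, b⟩ | a
    · rw [hl_inl] at h
      change _ = Sum.inl (a, !b)
      rw [hl_inl, G.toUEdge_inv, (ho a.1 a.2).1 e h.1, h.2]
      exact ⟨h.1, rfl⟩
    · rw [hl_inr] at h
      change _ = Sum.inr a
      rw [hl_inr, G.toUEdge_inv, h]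
  · rintro x (⟨a, b⟩ | a)
    · obtain ⟨e, ⟨h1, h2, h3⟩, h4⟩ := (ho a.1 a.2).2 x b
      refine ⟨e, ⟨h2, (hl_inl _ _ _).2 ⟨h1, h3⟩⟩, ?_⟩
      rintro e' ⟨h5, h6⟩
      obtain ⟨h7, h8⟩ := (hl_inl _ _ _).1 h6
      exact h4 e' ⟨h7, h5, h8⟩
    · obtain ⟨e, ⟨h1, h2⟩, h3⟩ := a.2 x
      refine ⟨G.inv e, ⟨by rw [G.inv_inv, h2], (hl_inr _ _).2 (by rw [G.toUEdge_inv, h1])⟩, ?_⟩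
      rintro e' ⟨h4, h5⟩
      rw [hl_inr] at h5
      rw [← h3 (G.inv e') ⟨by rw [G.toUEdge_inv, h5], h4⟩, G.inv_inv]

end SerreGraph

namespace PartitePresentation

variable (P : PartitePresentation.{u})

theorem conj_mem_relSubgroup {x : P.X} {g : P.MF} (hg : g ∈ P.relSubgroup x) (k : P.MF) :
    k⁻¹ * g * k ∈ P.relSubgroup (P.act x k) := by
  induction hg using Subgroup.closure_induction with
  | mem g hg =>
    obtain ⟨w, r, hr, rfl⟩ := hg
    refine Subgroup.subset_closure ⟨k⁻¹ * w, r, ?_, by group⟩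
    rwa [← P.act_mul, mul_inv_cancel_left]
  | one => simp
  | mul g h _ _ hg hh =>
    convert mul_mem hg hh using 1
    group
  | inv g _ hg =>
    convert inv_mem hg using 1
    group

theorem vertexSetoid_mul_right {b : P.X} {g h : P.MF} (hgh : P.vertexSetoid b g h) (k : P.MF) :
    P.vertexSetoid b (g * k) (h * k) := by
  obtain ⟨h1, h2⟩ := hgh
  refine ⟨by rw [P.act_mul, P.act_mul, h1], ?_⟩
  rw [P.act_mul]
  convert P.conj_mem_relSubgroup h2 k using 1
  group

/-- The labelling of the partite Cayley graph by the colours of its directed edges. -/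
def labelling (b : P.X) : (P.SpAt b).Labelling P.U P.I where
  label := Quotient.lift (s := P.edgeSetoid b) Prod.snd fun _ _ h => h.1
  label_inv := by
    rintro ⟨g, s⟩
    rcases s with ⟨a, b⟩ | i <;> rfl
  existsUnique := by
    rintro ⟨g⟩ s
    have hsource : ∀ e : P.MF × P.Letter, (P.SpAt b).tau ((P.SpAt b).inv
        (Quotient.mk (P.edgeSetoid b) e)) = Quotient.mk (P.vertexSetoid b) e.1 :=
      fun e => congrArg (Quotient.mk (P.vertexSetoid b)) (P.tree_tau_inv e)
    refine ⟨Quotient.mk (P.edgeSetoid b) (g, s), ⟨hsource _, rfl⟩, ?_⟩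
    rintro ⟨h, t⟩ ⟨h1, h2⟩
    have h3 : t = s := h2
    subst h3
    have h4 : P.vertexSetoid b h g := Quotient.exact ((hsource (h, t)).symm.trans h1)
    exact Quotient.sound (s := P.edgeSetoid b) ⟨rfl, P.vertexSetoid_mul_right h4 _, h4⟩

end PartitePresentation

namespace SerreGraph.Labelling

variable {G : SerreGraph.{u}} {U I : Type u} (L : G.Labelling U I)

/-- The permutation of the vertices given by a generator. -/
noncomputable def genPerm (s : U ⊕ I) : Equiv.Perm G.V := L.perm (letterOf s)

theorem genPerm_invol (i : I) (x : G.V) :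
    L.genPerm (Sum.inr i) (L.genPerm (Sum.inr i) x) = x :=
  L.next_letterInv_next (Sum.inr i) x

/-- The group element denoted by a letter. -/
def letterVal : (U × Bool) ⊕ I → MixedFreeGroup U I
  | Sum.inl (a, true) => PresentedGroup.of (Sum.inl a)
  | Sum.inl (a, false) => (PresentedGroup.of (Sum.inl a))⁻¹
  | Sum.inr i => PresentedGroup.of (Sum.inr i)

theorem mixedAction_letterVal (s : (U × Bool) ⊕ I) (x : G.V) :
    (mixedAction L.genPerm L.genPerm_invol (letterVal s)).unop x = L.next s x := by
  rcases s with ⟨a, _ | _⟩ | i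
  · simp only [letterVal, map_inv, mixedAction, PresentedGroup.toGroup.of]
    rfl
  · simp only [letterVal, mixedAction, PresentedGroup.toGroup.of]
    rfl
  · simp only [letterVal, mixedAction, PresentedGroup.toGroup.of]
    rfl

theorem exists_mixedAction_eq (hG : G.Connected) (x y : G.V) :
    ∃ g : MixedFreeGroup U I, (mixedAction L.genPerm L.genPerm_invol g).unop x = y := by
  induction hG.2 x y with
  | refl => exact ⟨1, by simp⟩
  | tail _ h ih =>
    obtain ⟨g, rfl⟩ := ih
    obtain ⟨e, h1, rfl⟩ := h
    refine ⟨g * letterVal (L.label e), ?_⟩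
    rw [map_mul, MulOpposite.unop_mul, Equiv.Perm.mul_apply, L.mixedAction_letterVal, ← h1, next,
      ← L.eq_edge]

/-- The partite presentation with one class for each vertex, in which every element of the
stabiliser of a class is a relator. -/
noncomputable def presentation (hG : G.Connected) : PartitePresentation.{u} where
  X := G.V
  U := U
  I := I
  nonempty := hG.1
  φ := L.genPerm
  φ_invol := L.genPerm_invol
  φ_fixfree _ x := L.next_ne_self rfl x
  transitive := L.exists_mixedAction_eq hG
  R x := {g | (mixedAction L.genPerm L.genPerm_invol g).unop x = x}
  R_stab _ _ hr := hr

theorem presentation_act_val (hG : G.Connected) (x : G.V) (s : (U × Bool) ⊕ I) :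
    (L.presentation hG).act x (PartitePresentation.Letter.val (L.presentation hG) s) =
      L.next s x := by
  rw [← L.mixedAction_letterVal]
  rcases s with ⟨a, _ | _⟩ | i <;> rfl

theorem presentation_vertexSetoid (hG : G.Connected) (b : (L.presentation hG).X)
    (g h : (L.presentation hG).MF) :
    (L.presentation hG).vertexSetoid b g h ↔
      (L.presentation hG).act b g = (L.presentation hG).act b h := by
  refine ⟨fun h => h.1, fun hgh => ⟨hgh, Subgroup.subset_closure ⟨1, g⁻¹ * h, ?_, by simp⟩⟩⟩
  rw [PartitePresentation.act_one]
  change (L.presentation hG).act _ (g⁻¹ * h) = _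
  rw [← PartitePresentation.act_mul, mul_inv_cancel_left, hgh]

theorem nonempty_iso_presentation (hG : G.Connected) :
    Nonempty (Iso G (L.presentation hG).Sp) := by
  set P := L.presentation hG with hP
  suffices h : ∀ b : P.X, Nonempty (Iso (P.SpAt b) G) by
    obtain ⟨f⟩ := h (Classical.choice P.nonempty)
    exact ⟨f.symm⟩
  intro b
  have hact : ∀ (g : P.MF) (s : P.Letter),
      P.act b (g * PartitePresentation.Letter.val P s) = L.next s (P.act b g) := by
    intro g s
    rw [P.act_mul]
    exact L.presentation_act_val hG _ s
  have hE : ∀ e f : P.MF × P.Letter, P.edgeSetoid b e f →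
      L.edge (P.act b e.1) e.2 = L.edge (P.act b f.1) f.2 := by
    rintro e f ⟨h1, -, h2⟩
    rw [h1, h2.1]
  refine ⟨⟨Equiv.ofBijective (Quotient.lift (s := P.vertexSetoid b) (P.act b) fun _ _ h => h.1)
    ⟨?_, ?_⟩, Equiv.ofBijective (Quotient.lift (s := P.edgeSetoid b)
      (fun e => L.edge (P.act b e.1) e.2) hE) ⟨?_, ?_⟩, ?_, ?_⟩⟩
  · rintro ⟨g⟩ ⟨h⟩ hgh
    exact Quotient.sound (s := P.vertexSetoid b) ((L.presentation_vertexSetoid hG b g h).2 hgh)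
  · intro y
    obtain ⟨g, hg⟩ := P.transitive b y
    exact ⟨Quotient.mk (P.vertexSetoid b) g, hg⟩
  · rintro ⟨g, s⟩ ⟨h, t⟩ hgh
    obtain ⟨h1, h2⟩ := L.edge_injective hgh
    have h3 : s = t := h2
    subst h3
    have h4 := (L.presentation_vertexSetoid hG b g h).2 h1
    exact Quotient.sound (s := P.edgeSetoid b) ⟨rfl, P.vertexSetoid_mul_right h4 _, h4⟩
  · intro e
    obtain ⟨g, hg⟩ := P.transitive b (G.tau (G.inv e))
    refine ⟨Quotient.mk (P.edgeSetoid b) (g, L.label e), ?_⟩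
    change L.edge (P.act b g) (L.label e) = e
    have hg' : P.act b g = G.tau (G.inv e) := hg
    rw [hg']
    exact (L.eq_edge e).symm
  · rintro ⟨g, s⟩
    change L.edge (P.act b (g * PartitePresentation.Letter.val P s))
      (PartitePresentation.Letter.inv P s) = G.inv (L.edge (P.act b g) s)
    rw [hact]
    refine Eq.trans ?_ (L.inv_edge _ _).symm
    rcases s with ⟨a, b⟩ | i <;> rfl
  · rintro ⟨g, s⟩
    exact hact g s

end SerreGraph.Labelling

theorem mainTheorem4 (G : SerreGraph.{u}) (hG : G.Connected) :
    (∃ (Ω : Type u) (c : G.UEdge → Ω),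
        G.IsWeakMulticycleColouring c ∧ G.IsPartitionFriendly c) ↔
      ∃ P : PartitePresentation.{u}, Nonempty (SerreGraph.Iso G P.Sp) := by
  constructor
  · rintro ⟨Ω, c, hc, hr⟩
    obtain ⟨U, I, ⟨L⟩⟩ := SerreGraph.exists_labelling c hc hr
    exact ⟨L.presentation hG, L.nonempty_iso_presentation hG⟩
  · rintro ⟨P, ⟨f⟩⟩
    let L : G.Labelling P.U P.I := (P.labelling (Classical.choice P.nonempty)).comap f
    exact ⟨P.U ⊕ P.I, L.colour, L.isWeakMulticycleColouring_colour, L.isPartitionFriendly_colour⟩
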